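/- Let $\{\mathbf x_k\}_{k\in\mathbb Z}$ and $\{\mathbf y_k\}_{k\in\mathbb Z}$ be discrete-time stochastic processes with values in $\mathbb R^m$ and finite second moments, with laws $p_{\{\mathbf x_k\}}$ and $p_{\{\mathbf y_k\}}$; they need not be elliptical. Assume that both are stationary, i.e. $\mathbb E[\mathbf x_i\mathbf x_{i+k}^{\mathrm T}]=R_{\mathbf x}(k)$ depends only on $k$, and likewise for $\mathbf y$, and that the power spectra $$\Phi_{\mathbf x}(\omega)=\sum_{k=-\infty}^{\infty}R_{\mathbf x}(k)\,e^{-\mathrm j\omega k},\qquad \Phi_{\mathbf y}(\omega)=\sum_{k=-\infty}^{\infty}R_{\mathbf y}(k)\,e^{-\mathrm j\omega k}$$ exist for every $\omega\in\mathbb R$, as limits of the symmetric partial sums $\sum_{k=-N}^{N}$ for $N\to\infty$. (They are then automatically Hermitian positive semidefinite.) Define the average $\mathcal W_2$ distance by $$\mathcal W_2\left(p_{\{\mathbf x_k\}};p_{\{\mathbf y_k\}}\right)=\left(\inf\ \limsup_{i\to\infty}\frac{\mathbb E\left[\sum_{k=0}^{i}\|\mathbf x_k-\mathbf y_k\|^2\right]}{i+1}\right)^{1/2},$$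 where the infimum is over all couplings, i.e. all joint laws of $(\{\mathbf x_k\},\{\mathbf y_k\})$ with marginals $p_{\{\mathbf x_k\}}$ and $p_{\{\mathbf y_k\}}$, and $\|\cdot\|$ is the Euclidean norm. Put $$W[\Phi_{\mathbf x}(\omega),\Phi_{\mathbf y}(\omega)]=\Phi_{\mathbf x}(\omega)+\Phi_{\mathbf y}(\omega)-2\left[\Phi_{\mathbf x}^{1/2}(\omega)\,\Phi_{\mathbf y}(\omega)\,\Phi_{\mathbf x}^{1/2}(\omega)\right]^{1/2},$$ with positive semidefinite square roots. Then $\omega\mapsto\operatorname{tr}W[\Phi_{\mathbf x}(\omega),\Phi_{\mathbf y}(\omega)]$ is integrable on $[0,2\pi]$ and $$\mathcal W_2\left(p_{\{\mathbf x_k\}};p_{\{\mathbf y_k\}}\right)\ \ge\ \sqrt{\frac1{2\pi}\int_0^{2\pi}\operatorname{tr}W[\Phi_{\mathbf x}(\omega),\Phi_{\mathbf y}(\omega)]\,\mathrm d\omega}.$$ -/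

import Mathlib

open MeasureTheory Filter Topology
open scoped ENNReal MatrixOrder

noncomputable section

namespace SpectralW2

/-- Euclidean `m`-space, the state space of an `m`-dimensional process. -/
abbrev E (m : ℕ) : Type := EuclideanSpace ℝ (Fin m)

/-- The law of a process `{x_k}`, a measure on the space of two-sided sequences. -/
def law {m : ℕ} {Ω : Type*} [MeasurableSpace Ω] (P : Measure Ω) (x : ℤ → Ω → E m) :
    Measure (ℤ → E m) :=
  P.map (fun s k => x k s)

/-- The auto-correlation `R(i, k) = 𝔼[x_i x_{i+k}ᵀ]`. -/
def autocorr {m : ℕ} {Ω : Type*} [MeasurableSpace Ω] (P : Measure Ω) (x : ℤ → Ω → E m)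
    (i k : ℤ) : Matrix (Fin m) (Fin m) ℝ :=
  Matrix.of fun a b => ∫ s, x i s a * x (i + k) s b ∂P

/-- A second-order process is stationary if `R(i, k)` depends only on the lag `k`. -/
structure IsStationary {m : ℕ} {Ω : Type*} [MeasurableSpace Ω] (P : Measure Ω)
    (x : ℤ → Ω → E m) : Prop where
  memLp_two : ∀ k, MemLp (x k) 2 P
  autocorr_eq : ∀ i j k, autocorr P x i k = autocorr P x j k

/-- `Φ` is the power spectrum of the stationary process `x`: for every frequency `ω`,
`Φ(ω) = ∑_{k = -∞}^{∞} R(k) e^{-jωk}`, as the limit of the symmetric partial sums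
(absolute convergence is not required). -/
def IsPowerSpectrum {m : ℕ} {Ω : Type*} [MeasurableSpace Ω] (P : Measure Ω)
    (x : ℤ → Ω → E m) (Φ : ℝ → Matrix (Fin m) (Fin m) ℂ) : Prop :=
  ∀ ω : ℝ, Tendsto
    (fun N : ℕ => ∑ k ∈ Finset.Icc (-(N : ℤ)) (N : ℤ),
      Complex.exp (-(Complex.I * (ω : ℂ) * (k : ℂ))) • (autocorr P x 0 k).map Complex.ofReal)
    atTop (𝓝 (Φ ω))

/-- The couplings of two measures: joint laws with the prescribed marginals. -/
def couplings {α β : Type*} [MeasurableSpace α] [MeasurableSpace β]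
    (μ : Measure α) (ν : Measure β) : Set (Measure (α × β)) :=
  {γ | γ.map Prod.fst = μ ∧ γ.map Prod.snd = ν}

/-- The stacked vector `u_{0,…,i} = [u_0ᵀ, …, u_iᵀ]ᵀ`, with its Euclidean norm. -/
def stack {m : ℕ} (u : ℤ → E m) (i : ℕ) : PiLp 2 (fun _ : Fin (i + 1) => E m) :=
  WithLp.toLp 2 fun k => u (k : ℕ)

/-- The average Wasserstein distance of order `p` between two laws of processes,
`(inf limsup_{i → ∞} 𝔼 ‖x_{0,…,i} - y_{0,…,i}‖ ^ p / (i + 1)) ^ (1 / p)`,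
the infimum being over all couplings of the two laws. -/
def avgWasserstein {m : ℕ} (p : ℝ) (μ ν : Measure (ℤ → E m)) : ℝ≥0∞ :=
  (⨅ γ ∈ couplings μ ν,
    limsup (fun i : ℕ => (∫⁻ z, ‖stack z.1 i - stack z.2 i‖ₑ ^ p ∂γ) / ((i : ℝ≥0∞) + 1))
      atTop) ^ (1 / p)

/-- `W[A, B] = A + B - 2 (A^{1/2} B A^{1/2})^{1/2}`, with the positive semidefinite square root
of a positive semidefinite Hermitian matrix. -/
def gelbrich {m : ℕ} (A B : Matrix (Fin m) (Fin m) ℂ) : Matrix (Fin m) (Fin m) ℂ :=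
  A + B - (2 : ℂ) • CFC.sqrt (CFC.sqrt A * B * CFC.sqrt A)

end SpectralW2

end

/-!
Replace each spectrum by the expected periodogram, the second moment matrix of the normalized finite
Fourier transform. For a coupling of `x` and `y` and a fixed frequency, the joint second moment
matrix of the two transforms is positive semidefinite, so the Gelbrich bound for a single pair of
random vectors gives `tr W[periodogram x, periodogram y] ≤ tr (periodogram (x - y))`. By Parseval,
the right side integrates over `[0, 2π]` to `2π` times the time average of `𝔼 ‖x_k - y_k‖²`, while
the left side depends only on the two marginal laws. For a stationary process the periodograms are
Cesàro means of the symmetric partial sums of the spectrum, hence converge to it at every frequency.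
Fatou's lemma then gives both the integrability and the bound.

The Gelbrich bound `Re tr K ≤ tr (A^{1/2} B A^{1/2})^{1/2}` for a positive semidefinite block matrix
`[A, K; Kᴴ, B]` is a duality argument: pair the block matrix with `[T, -1; -1, T⁻¹]`, where `T` is
the optimal transport map from `A` to `B`, and remove nondegeneracy by continuity.
-/

namespace SpectralW2

open ProbabilityTheory (IdentDistrib)
open scoped ComplexOrder Matrix

section Fidelity

theorem trace_mul_nonneg_of_posSemidef {n : Type*} [Fintype n] {A B : Matrix n n ℂ}
    (hA : A.PosSemidef) (hB : B.PosSemidef) : 0 ≤ (A * B).trace := by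
  classical
  obtain ⟨C, rfl⟩ := CStarAlgebra.nonneg_iff_eq_star_mul_self.mp hA.nonneg
  rw [Matrix.star_eq_conjTranspose, mul_assoc, Matrix.trace_mul_comm]
  exact (hB.mul_mul_conjTranspose_same C).trace_nonneg

theorem trace_fromBlocks {n n' α : Type*} [Fintype n] [Fintype n'] [AddCommMonoid α]
    (A : Matrix n n α) (B : Matrix n n' α) (C : Matrix n' n α) (D : Matrix n' n' α) :
    (Matrix.fromBlocks A B C D).trace = A.trace + D.trace := by
  simp [Matrix.trace]

theorem continuous_re_trace {n : Type*} [Fintype n] :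
    Continuous fun A : Matrix n n ℂ => A.trace.re :=
  Complex.continuous_re.comp continuous_id.matrix_trace

variable {n : Type*} [DecidableEq n] {A B K : Matrix n n ℂ}

theorem posDef_add_smul_one (hA : A.PosSemidef) {ε : ℝ} (hε : 0 < ε) :
    (A + ε • (1 : Matrix n n ℂ)).PosDef :=
  Matrix.PosDef.posSemidef_add hA (Matrix.PosDef.one.smul hε)

theorem tendsto_add_smul_one (A : Matrix n n ℂ) :
    Tendsto (fun ε : ℝ => A + ε • (1 : Matrix n n ℂ)) (𝓝[>] 0) (𝓝 A) :=
  tendsto_nhdsWithin_of_tendsto_nhds <| Continuous.tendsto' (by fun_prop) _ _ (by simp)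

variable [Fintype n]

open scoped Matrix.Norms.L2Operator in
theorem tendsto_sqrt {ι : Type*} {l : Filter ι} {F : ι → Matrix n n ℂ}
    (hF : ∀ᶠ i in l, (F i).PosSemidef) (hA : A.PosSemidef) (h : Tendsto F l (𝓝 A)) :
    Tendsto (fun i => CFC.sqrt (F i)) l (𝓝 (CFC.sqrt A)) :=
  (CFC.continuousOn_sqrt A hA.nonneg).tendsto.comp <|
    tendsto_nhdsWithin_iff.2 ⟨h, hF.mono fun _ hi => hi.nonneg⟩

theorem posSemidef_sqrt_mul_mul_sqrt (A : Matrix n n ℂ) (hB : B.PosSemidef) :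
    (CFC.sqrt A * B * CFC.sqrt A).PosSemidef :=
  Matrix.nonneg_iff_posSemidef.1 <|
    (CFC.sqrt_nonneg A).isSelfAdjoint.conjugate_nonneg hB.nonneg

/-- The fidelity `tr (A^{1/2} B A^{1/2})^{1/2}` of two positive semidefinite matrices, which is
the optimal cross term in the Gelbrich distance. -/
noncomputable def fidelity (A B : Matrix n n ℂ) : ℝ :=
  (CFC.sqrt (CFC.sqrt A * B * CFC.sqrt A)).trace.re

theorem fidelity_nonneg (A B : Matrix n n ℂ) : 0 ≤ fidelity A B :=
  (Complex.nonneg_iff.1 (Matrix.nonneg_iff_posSemidef.1 (CFC.sqrt_nonneg _)).trace_nonneg).1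

theorem tendsto_fidelity {ι : Type*} {l : Filter ι} {F G : ι → Matrix n n ℂ}
    (hF : ∀ᶠ i in l, (F i).PosSemidef) (hG : ∀ᶠ i in l, (G i).PosSemidef)
    (hA : A.PosSemidef) (hB : B.PosSemidef) (hFA : Tendsto F l (𝓝 A)) (hGB : Tendsto G l (𝓝 B)) :
    Tendsto (fun i => fidelity (F i) (G i)) l (𝓝 (fidelity A B)) := by
  have hsqrt := tendsto_sqrt hF hA hFA
  have hsqrt₂ := tendsto_sqrt (hG.mono fun i hi => posSemidef_sqrt_mul_mul_sqrt (F i) hi)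
    (posSemidef_sqrt_mul_mul_sqrt A hB) ((hsqrt.mul hGB).mul hsqrt)
  exact (continuous_re_trace.tendsto _).comp hsqrt₂

theorem tendsto_fidelity_add_smul_one (hA : A.PosSemidef) (hB : B.PosSemidef) :
    Tendsto (fun ε : ℝ => fidelity (A + ε • (1 : Matrix n n ℂ)) (B + ε • (1 : Matrix n n ℂ)))
      (𝓝[>] 0) (𝓝 (fidelity A B)) := by
  refine tendsto_fidelity ?_ ?_ hA hB (tendsto_add_smul_one A) (tendsto_add_smul_one B) <;>
  filter_upwards [self_mem_nhdsWithin] with ε hε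
  exacts [(posDef_add_smul_one hA hε).posSemidef, (posDef_add_smul_one hB hε).posSemidef]

/-- The optimal transport map `A^{-1/2} (A^{1/2} B A^{1/2})^{1/2} A^{-1/2}` between the centred
Gaussians with nondegenerate covariances `A` and `B`. -/
noncomputable def transportMap (A B : Matrix n n ℂ) : Matrix n n ℂ :=
  (CFC.sqrt A)⁻¹ * CFC.sqrt (CFC.sqrt A * B * CFC.sqrt A) * (CFC.sqrt A)⁻¹

theorem posDef_sqrt (hA : A.PosDef) : (CFC.sqrt A).PosDef :=
  (Matrix.nonneg_iff_posSemidef.1 (CFC.sqrt_nonneg A)).posDef_iff_isUnit.2 <|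
    (CFC.isUnit_sqrt_iff A hA.posSemidef.nonneg).2 hA.isUnit

theorem posDef_transportMap (hA : A.PosDef) (hB : B.PosDef) : (transportMap A B).PosDef := by
  have hP := posDef_sqrt hA
  have conj {S C : Matrix n n ℂ} (hS : S.PosDef) (hC : C.PosDef) : (S * C * S).PosDef := by
    simpa only [Matrix.star_eq_conjTranspose, hS.isHermitian.eq] using
      (Matrix.IsUnit.posDef_star_left_conjugate_iff hS.isUnit).2 hC
  exact conj hP.inv (posDef_sqrt (conj hP hB))

theorem sqrt_mul_transportMap_mul_sqrt (hA : A.PosDef) (B : Matrix n n ℂ) :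
    CFC.sqrt A * transportMap A B * CFC.sqrt A =
      CFC.sqrt (CFC.sqrt A * B * CFC.sqrt A) := by
  have hP : IsUnit (CFC.sqrt A).det := (Matrix.isUnit_iff_isUnit_det _).1 (posDef_sqrt hA).isUnit
  simp only [transportMap, mul_assoc, Matrix.nonsing_inv_mul _ hP,
    Matrix.mul_nonsing_inv_cancel_left _ _ hP, mul_one]

theorem transportMap_mul_mul_transportMap (hA : A.PosDef) (hB : B.PosSemidef) :
    transportMap A B * A * transportMap A B = B := by
  set P := CFC.sqrt A
  set T := transportMap A B
  have hPu : IsUnit P := (posDef_sqrt hA).isUnit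
  have hPP : P * P = A := CFC.sqrt_mul_sqrt_self A hA.posSemidef.nonneg
  refine hPu.mul_left_cancel (hPu.mul_right_cancel ?_)
  calc P * (T * A * T) * P = (P * T * P) * (P * T * P) := by rw [← hPP]; noncomm_ring
    _ = P * B * P := by
      rw [sqrt_mul_transportMap_mul_sqrt hA]
      exact CFC.sqrt_mul_sqrt_self _ (posSemidef_sqrt_mul_mul_sqrt A hB).nonneg

theorem re_trace_transportMap_mul (hA : A.PosDef) (B : Matrix n n ℂ) :
    (transportMap A B * A).trace.re = fidelity A B := by
  have hPP : CFC.sqrt A * CFC.sqrt A = A := CFC.sqrt_mul_sqrt_self A hA.posSemidef.nonneg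
  rw [fidelity, ← sqrt_mul_transportMap_mul_sqrt hA, Matrix.trace_mul_comm (CFC.sqrt A * _),
    ← mul_assoc, hPP, Matrix.trace_mul_comm]

theorem two_mul_fidelity_le_of_posDef (hA : A.PosDef) (hB : B.PosDef) :
    2 * fidelity A B ≤ A.trace.re + B.trace.re := by
  set T := transportMap A B
  have hT : Tᴴ = T := (posDef_transportMap hA hB).isHermitian
  have hexpand : (1 - T) * A * (1 - T)ᴴ = A - T * A - A * T + B := by
    rw [Matrix.conjTranspose_sub, Matrix.conjTranspose_one, hT,
      ← transportMap_mul_mul_transportMap hA hB.posSemidef]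
    noncomm_ring
  have hnonneg := (Complex.nonneg_iff.1
    (hA.posSemidef.mul_mul_conjTranspose_same (1 - T)).trace_nonneg).1
  rw [hexpand, Matrix.trace_add, Matrix.trace_sub, Matrix.trace_sub, Matrix.trace_mul_comm A T,
    Complex.add_re, Complex.sub_re, Complex.sub_re] at hnonneg
  simp only [T, re_trace_transportMap_mul hA] at hnonneg
  linarith

theorem two_mul_fidelity_le (hA : A.PosSemidef) (hB : B.PosSemidef) :
    2 * fidelity A B ≤ A.trace.re + B.trace.re := by
  have htrace (C : Matrix n n ℂ) :
      Tendsto (fun ε : ℝ => (C + ε • (1 : Matrix n n ℂ)).trace.re) (𝓝[>] 0) (𝓝 C.trace.re) :=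
    (continuous_re_trace.tendsto C).comp (tendsto_add_smul_one C)
  refine le_of_tendsto_of_tendsto ((tendsto_fidelity_add_smul_one hA hB).const_mul 2)
    ((htrace A).add (htrace B)) ?_
  filter_upwards [self_mem_nhdsWithin] with ε hε
  exact two_mul_fidelity_le_of_posDef (posDef_add_smul_one hA hε) (posDef_add_smul_one hB hε)

theorem posSemidef_fromBlocks_inv {T : Matrix n n ℂ} (hT : T.PosDef) :
    (Matrix.fromBlocks T (-1) (-1) T⁻¹).PosSemidef := by
  have := hT.isUnit.invertible
  have hschur := Matrix.PosDef.fromBlocks₁₁ (-1) T⁻¹ hT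
  rw [Matrix.conjTranspose_neg, Matrix.conjTranspose_one] at hschur
  refine hschur.2 ?_
  simp only [neg_mul, mul_neg, one_mul, mul_one, neg_neg, sub_self]
  exact Matrix.PosSemidef.zero

theorem re_trace_le_fidelity_of_posDef (hA : A.PosDef) (hB : B.PosDef)
    (h : (Matrix.fromBlocks A K Kᴴ B).PosSemidef) : K.trace.re ≤ fidelity A B := by
  set T := transportMap A B
  have hT : T.PosDef := posDef_transportMap hA hB
  have hTB : (T⁻¹ * B).trace = (T * A).trace := by
    rw [← transportMap_mul_mul_transportMap hA hB.posSemidef, mul_assoc,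
      Matrix.nonsing_inv_mul_cancel_left _ _ ((Matrix.isUnit_iff_isUnit_det _).1 hT.isUnit),
      Matrix.trace_mul_comm]
  have hnonneg := (Complex.nonneg_iff.1
    (trace_mul_nonneg_of_posSemidef (posSemidef_fromBlocks_inv hT) h)).1
  simp only [Matrix.fromBlocks_multiply, trace_fromBlocks, Matrix.trace_add, neg_mul,
    one_mul, Matrix.trace_neg, Matrix.trace_conjTranspose, hTB, Complex.add_re, Complex.neg_re,
    Complex.star_def, Complex.conj_re, T, re_trace_transportMap_mul hA] at hnonneg
  linarith

theorem re_trace_le_fidelity (hA : A.PosSemidef) (hB : B.PosSemidef)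
    (h : (Matrix.fromBlocks A K Kᴴ B).PosSemidef) : K.trace.re ≤ fidelity A B := by
  refine ge_of_tendsto (tendsto_fidelity_add_smul_one hA hB) ?_
  filter_upwards [self_mem_nhdsWithin] with ε hε
  refine re_trace_le_fidelity_of_posDef (posDef_add_smul_one hA hε) (posDef_add_smul_one hB hε) ?_
  have hblock := (posDef_add_smul_one h hε).posSemidef
  rwa [← Matrix.fromBlocks_one, Matrix.fromBlocks_smul, Matrix.fromBlocks_add, smul_zero, add_zero,
    add_zero] at hblock

end Fidelity

section Gelbrich

variable {m : ℕ} {A B : Matrix (Fin m) (Fin m) ℂ}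

theorem re_trace_gelbrich (A B : Matrix (Fin m) (Fin m) ℂ) :
    (gelbrich A B).trace.re = A.trace.re + B.trace.re - 2 * fidelity A B := by
  simp [gelbrich, fidelity, Matrix.trace_sub, Matrix.trace_add, Matrix.trace_smul]

theorem re_trace_gelbrich_nonneg (hA : A.PosSemidef) (hB : B.PosSemidef) :
    0 ≤ (gelbrich A B).trace.re := by
  rw [re_trace_gelbrich]
  exact sub_nonneg.2 (two_mul_fidelity_le hA hB)

theorem re_trace_gelbrich_le (A B : Matrix (Fin m) (Fin m) ℂ) :
    (gelbrich A B).trace.re ≤ A.trace.re + B.trace.re := by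
  rw [re_trace_gelbrich]
  exact sub_le_self _ (mul_nonneg zero_le_two (fidelity_nonneg A B))

theorem tendsto_re_trace_gelbrich {ι : Type*} {l : Filter ι}
    {F G : ι → Matrix (Fin m) (Fin m) ℂ}
    (hF : ∀ᶠ i in l, (F i).PosSemidef) (hG : ∀ᶠ i in l, (G i).PosSemidef)
    (hA : A.PosSemidef) (hB : B.PosSemidef) (hFA : Tendsto F l (𝓝 A)) (hGB : Tendsto G l (𝓝 B)) :
    Tendsto (fun i => (gelbrich (F i) (G i)).trace.re) l (𝓝 (gelbrich A B).trace.re) := by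
  have htrace (C : Matrix (Fin m) (Fin m) ℂ) := continuous_re_trace.tendsto C
  simp only [re_trace_gelbrich]
  exact (((htrace A).comp hFA).add ((htrace B).comp hGB)).sub
    ((tendsto_fidelity hF hG hA hB hFA hGB).const_mul 2)

end Gelbrich

section Moments

variable {n n' Z : Type*} [MeasurableSpace Z] {γ : Measure Z}

/-- The cross second moment `𝔼[X Yᴴ]` of two complex random vectors, possibly of different
dimensions. -/
noncomputable def crossMoment (γ : Measure Z) (X : Z → n → ℂ) (Y : Z → n' → ℂ) : Matrix n n' ℂ :=
  Matrix.of fun a b => ∫ z, X z a * star (Y z b) ∂γ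

theorem conjTranspose_crossMoment (X : Z → n → ℂ) (Y : Z → n' → ℂ) :
    (crossMoment γ X Y)ᴴ = crossMoment γ Y X := by
  ext a b
  simp only [Matrix.conjTranspose_apply, crossMoment, Matrix.of_apply, Complex.star_def,
    ← integral_conj, map_mul, Complex.conj_conj, mul_comm]

theorem crossMoment_sumElim (X : Z → n → ℂ) (Y : Z → n' → ℂ) :
    crossMoment γ (fun z => Sum.elim (X z) (Y z)) (fun z => Sum.elim (X z) (Y z)) =
      Matrix.fromBlocks (crossMoment γ X X) (crossMoment γ X Y) (crossMoment γ Y X)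
        (crossMoment γ Y Y) := by
  ext (a | a) (b | b) <;> rfl

variable [Fintype n] [Fintype n'] {X X' : Z → n → ℂ} {Y : Z → n' → ℂ}

theorem integrable_mul_star (hX : MemLp X 2 γ) (hY : MemLp Y 2 γ) (a : n) (b : n') :
    Integrable (fun z => X z a * star (Y z b)) γ :=
  (hX.eval a).integrable_mul (hY.eval b).star

theorem crossMoment_sub_left (hX : MemLp X 2 γ) (hX' : MemLp X' 2 γ) (hY : MemLp Y 2 γ) :
    crossMoment γ (X - X') Y = crossMoment γ X Y - crossMoment γ X' Y := by
  ext a b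
  simp only [crossMoment, Matrix.of_apply, Matrix.sub_apply, Pi.sub_apply, sub_mul]
  exact integral_sub (integrable_mul_star hX hY a b) (integrable_mul_star hX' hY a b)

theorem crossMoment_sub_right (hY : MemLp Y 2 γ) (hX : MemLp X 2 γ) (hX' : MemLp X' 2 γ) :
    crossMoment γ Y (X - X') = crossMoment γ Y X - crossMoment γ Y X' := by
  rw [← conjTranspose_crossMoment, crossMoment_sub_left hX hX' hY, Matrix.conjTranspose_sub,
    conjTranspose_crossMoment, conjTranspose_crossMoment]

theorem crossMoment_sum_smul {ι : Type*} (s : Finset ι) (w : ι → ℂ) {U : ι → Z → n → ℂ}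
    (hU : ∀ i, MemLp (U i) 2 γ) :
    crossMoment γ (∑ i ∈ s, w i • U i) (∑ i ∈ s, w i • U i) =
      ∑ i ∈ s, ∑ j ∈ s, (w i * star (w j)) • crossMoment γ (U i) (U j) := by
  ext a b
  have hexpand (z : Z) : (∑ i ∈ s, w i • U i) z a * star ((∑ i ∈ s, w i • U i) z b) =
      ∑ i ∈ s, ∑ j ∈ s, (w i * star (w j)) * (U i z a * star (U j z b)) := by
    simp only [Finset.sum_apply, Pi.smul_apply, smul_eq_mul, star_sum, star_mul',
      Finset.sum_mul_sum, mul_mul_mul_comm]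
  have hint (i j : ι) : Integrable (fun z => (w i * star (w j)) * (U i z a * star (U j z b))) γ :=
    (integrable_mul_star (hU i) (hU j) a b).const_mul _
  simp only [crossMoment, Matrix.of_apply, hexpand, Matrix.sum_apply, Matrix.smul_apply,
    smul_eq_mul]
  rw [integral_finsetSum _ fun i _ => integrable_finsetSum _ fun j _ => hint i j]
  simp only [integral_finsetSum s fun j _ => hint _ j, integral_const_mul]

theorem posSemidef_crossMoment_self (hX : MemLp X 2 γ) : (crossMoment γ X X).PosSemidef := by
  refine .of_dotProduct_mulVec_nonneg (conjTranspose_crossMoment X X) fun v => ?_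
  have hint (a b : n) : Integrable (fun z => star (v a) * v b * (X z a * star (X z b))) γ :=
    (integrable_mul_star hX hX a b).const_mul _
  have hquad : star v ⬝ᵥ crossMoment γ X X *ᵥ v =
      ∫ z, (star v ⬝ᵥ X z) * star (star v ⬝ᵥ X z) ∂γ :=
    calc star v ⬝ᵥ crossMoment γ X X *ᵥ v
        = ∑ a, ∑ b, ∫ z, star (v a) * v b * (X z a * star (X z b)) ∂γ := by
          simp only [integral_const_mul, dotProduct, Matrix.mulVec, crossMoment, Matrix.of_apply,
            Finset.mul_sum, Pi.star_apply]
          exact Finset.sum_congr rfl fun a _ => Finset.sum_congr rfl fun b _ => by ring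
      _ = ∫ z, ∑ a, ∑ b, star (v a) * v b * (X z a * star (X z b)) ∂γ := by
          rw [integral_finsetSum _ fun a _ => integrable_finsetSum _ fun b _ => hint a b]
          simp only [integral_finsetSum _ fun b _ => hint _ b]
      _ = ∫ z, (star v ⬝ᵥ X z) * star (star v ⬝ᵥ X z) ∂γ := by
          simp only [dotProduct, star_sum, star_mul', Finset.sum_mul_sum, Pi.star_apply, star_star,
            mul_mul_mul_comm]
  rw [hquad]
  exact integral_nonneg fun z => mul_star_self_nonneg _

theorem posSemidef_fromBlocks_crossMoment (hX : MemLp X 2 γ) (hY : MemLp Y 2 γ) :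
    (Matrix.fromBlocks (crossMoment γ X X) (crossMoment γ X Y) (crossMoment γ X Y)ᴴ
      (crossMoment γ Y Y)).PosSemidef := by
  have hXY : MemLp (fun z => Sum.elim (X z) (Y z)) 2 γ :=
    .of_eval (by rintro (a | a); exacts [hX.eval a, hY.eval a])
  rw [conjTranspose_crossMoment, ← crossMoment_sumElim]
  exact posSemidef_crossMoment_self hXY

theorem re_trace_gelbrich_crossMoment_le {m : ℕ} {X Y : Z → Fin m → ℂ} (hX : MemLp X 2 γ)
    (hY : MemLp Y 2 γ) :
    (gelbrich (crossMoment γ X X) (crossMoment γ Y Y)).trace.re ≤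
      (crossMoment γ (X - Y) (X - Y)).trace.re := by
  have hcross : (crossMoment γ X Y).trace.re ≤ fidelity (crossMoment γ X X) (crossMoment γ Y Y) :=
    re_trace_le_fidelity (posSemidef_crossMoment_self hX) (posSemidef_crossMoment_self hY)
      (posSemidef_fromBlocks_crossMoment hX hY)
  have hYX : (crossMoment γ Y X).trace.re = (crossMoment γ X Y).trace.re := by
    rw [← conjTranspose_crossMoment, Matrix.trace_conjTranspose, Complex.star_def, Complex.conj_re]
  rw [re_trace_gelbrich, crossMoment_sub_left hX hY (hX.sub hY), crossMoment_sub_right hX hX hY,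
    crossMoment_sub_right hY hX hY]
  simp only [Matrix.trace_sub, Complex.sub_re, hYX]
  linarith

end Moments

section Trigonometric

theorem sum_Icc_neg_eq {M : Type*} [AddCommGroup M] (f : ℤ → M) (n : ℕ) :
    ∑ k ∈ Finset.Icc (-(n : ℤ)) n, f k =
      f 0 + ∑ i ∈ Finset.range n, f (i + 1) + ∑ i ∈ Finset.range n, f (-(i + 1)) := by
  induction n with
  | zero => simp
  | succ n ih =>
    rw [Nat.cast_succ, Finset.sum_Icc_succ_eq_add_endpoints, ih, Finset.sum_range_succ,
      Finset.sum_range_succ]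
    abel

theorem sum_sum_lag_eq {M : Type*} [AddCommGroup M] (f : ℤ → M) (n : ℕ) :
    ∑ i ∈ Finset.range n, ∑ j ∈ Finset.range n, f (j - i) =
      ∑ N ∈ Finset.range n, ∑ k ∈ Finset.Icc (-(N : ℤ)) N, f k := by
  have hreflect (g : ℤ → M) (n : ℕ) :
      ∑ i ∈ Finset.range n, g (n - i) = ∑ i ∈ Finset.range n, g (i + 1) := by
    rw [← Finset.sum_range_reflect]
    refine Finset.sum_congr rfl fun i hi => congrArg g ?_
    have := Finset.mem_range.1 hi
    omega
  induction n with
  | zero => simp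
  | succ n ih =>
    have hcol := hreflect f n
    have hrow : ∑ j ∈ Finset.range n, f (j - n) = ∑ j ∈ Finset.range n, f (-(j + 1)) := by
      simpa only [neg_sub] using hreflect (fun k => f (-k)) n
    rw [Finset.sum_range_succ (fun N : ℕ => ∑ k ∈ Finset.Icc (-(N : ℤ)) N, f k), ← ih,
      sum_Icc_neg_eq]
    simp only [Finset.sum_range_succ _ n, Finset.sum_add_distrib, hcol, hrow, sub_self]
    abel

theorem integral_cos_int_mul (k : ℤ) :
    ∫ ω in (0 : ℝ)..(2 * Real.pi), Real.cos (k * ω) = if k = 0 then 2 * Real.pi else 0 := by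
  split_ifs with h
  · simp [h]
  · have hk : (k : ℝ) ≠ 0 := Int.cast_ne_zero.2 h
    rw [intervalIntegral.integral_comp_mul_left _ hk, integral_cos, mul_zero, Real.sin_zero,
      show (k : ℝ) * (2 * Real.pi) = (k * 2 : ℤ) * Real.pi by push_cast; ring, Real.sin_int_mul_pi,
      sub_zero, smul_zero]

theorem re_exp_neg_I_mul (ω : ℝ) (k : ℤ) :
    (Complex.exp (-(Complex.I * ω * k))).re = Real.cos (k * ω) := by
  rw [show -(Complex.I * ω * k) = ((-(k * ω) : ℝ) : ℂ) * Complex.I by push_cast; ring,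
    Complex.exp_ofReal_mul_I_re, Real.cos_neg]

end Trigonometric

section Periodogram

variable {m : ℕ} {Z : Type*}

/-- A real vector seen as a complex one, so that it can carry Fourier weights. -/
def complexify (v : E m) : Fin m → ℂ := fun a => v a

/-- The normalized finite Fourier transform `n^{-1/2} ∑_{j < n} e^{iωj} u_j` of a process, the
random vector whose second moments at frequency `ω` approximate the power spectrum. -/
noncomputable def fourierSum (n : ℕ) (ω : ℝ) (u : ℤ → Z → E m) : Z → Fin m → ℂ :=
  ∑ j ∈ Finset.range n,
    (((√n)⁻¹ : ℝ) * Complex.exp (Complex.I * ω * j)) • fun z => complexify (u j z)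

theorem fourierSum_sub (u v : ℤ → Z → E m) (n : ℕ) (ω : ℝ) :
    fourierSum n ω (u - v) = fourierSum n ω u - fourierSum n ω v := by
  simp only [fourierSum, ← Finset.sum_sub_distrib, ← smul_sub]
  refine Finset.sum_congr rfl fun j _ => congrArg _ ?_
  ext z a
  exact Complex.ofReal_sub _ _

variable [MeasurableSpace Z] {γ : Measure Z} {u : ℤ → Z → E m}
  {Φ : ℝ → Matrix (Fin m) (Fin m) ℂ}

/-- The expected periodogram of a process, i.e. the second moment matrix of its normalized finite
Fourier transform. It estimates the power spectrum, but is positive semidefinite by construction. -/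
noncomputable def periodogram (γ : Measure Z) (u : ℤ → Z → E m) (n : ℕ) (ω : ℝ) :
    Matrix (Fin m) (Fin m) ℂ :=
  crossMoment γ (fourierSum n ω u) (fourierSum n ω u)

theorem memLp_complexify {w : Z → E m} (hw : MemLp w 2 γ) :
    MemLp (fun z => complexify (w z)) 2 γ :=
  .of_eval fun a => (hw.eval_piLp a).ofReal

theorem memLp_fourierSum (hu : ∀ k, MemLp (u k) 2 γ) (n : ℕ) (ω : ℝ) :
    MemLp (fourierSum n ω u) 2 γ :=
  memLp_finsetSum' _ fun j _ => (memLp_complexify (hu j)).const_smul _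

theorem crossMoment_complexify (u : ℤ → Z → E m) (i j : ℤ) :
    crossMoment γ (fun z => complexify (u i z)) (fun z => complexify (u j z)) =
      (autocorr γ u i (j - i)).map Complex.ofReal := by
  ext a b
  simp only [crossMoment, complexify, Matrix.of_apply, autocorr, Matrix.map_apply,
    add_sub_cancel, Complex.star_def, Complex.conj_ofReal, ← Complex.ofReal_mul]
  exact integral_ofReal

theorem posSemidef_periodogram (hu : ∀ k, MemLp (u k) 2 γ) (n : ℕ) (ω : ℝ) :
    (periodogram γ u n ω).PosSemidef :=
  posSemidef_crossMoment_self (memLp_fourierSum hu n ω)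

theorem fourier_weight_mul_star (n : ℕ) (ω : ℝ) (i j : ℤ) :
    (((√n)⁻¹ : ℝ) * Complex.exp (Complex.I * ω * i)) *
        star (((√n)⁻¹ : ℝ) * Complex.exp (Complex.I * ω * j)) =
      (n⁻¹ : ℝ) * Complex.exp (-(Complex.I * ω * (j - i : ℤ))) := by
  have hn : (((√n)⁻¹ : ℝ) : ℂ) * ((√n)⁻¹ : ℝ) = (n⁻¹ : ℝ) := by
    rw [← Complex.ofReal_mul, ← mul_inv, Real.mul_self_sqrt n.cast_nonneg]
  have hexp : star (Complex.exp (Complex.I * ω * j)) = Complex.exp (-(Complex.I * ω * j)) := by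
    simp [← Complex.exp_conj]
  rw [star_mul', hexp, Complex.star_def, Complex.conj_ofReal, mul_mul_mul_comm, hn,
    ← Complex.exp_add]
  congr 2
  push_cast
  ring

theorem periodogram_eq_sum (hu : ∀ k, MemLp (u k) 2 γ) (n : ℕ) (ω : ℝ) :
    periodogram γ u n ω =
      (n⁻¹ : ℝ) • ∑ i ∈ Finset.range n, ∑ j ∈ Finset.range n,
        Complex.exp (-(Complex.I * ω * (j - i : ℤ))) •
          (autocorr γ u i (j - i)).map Complex.ofReal := by
  have hweight (i j : ℕ) := fourier_weight_mul_star n ω i j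
  simp only [Int.cast_natCast] at hweight
  rw [periodogram, fourierSum, crossMoment_sum_smul _ _ fun j : ℕ => memLp_complexify (hu j)]
  simp only [crossMoment_complexify, hweight, Finset.smul_sum, mul_smul, Complex.coe_smul]

theorem continuous_periodogram (hu : ∀ k, MemLp (u k) 2 γ) (n : ℕ) :
    Continuous (periodogram γ u n) := by
  simp only [funext (periodogram_eq_sum hu n)]
  fun_prop

open scoped Matrix.Norms.L2Operator in
theorem tendsto_periodogram (hu : IsStationary γ u) (hΦ : IsPowerSpectrum γ u Φ) (ω : ℝ) :
    Tendsto (fun n => periodogram γ u n ω) atTop (𝓝 (Φ ω)) := by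
  simp only [periodogram_eq_sum hu.memLp_two, hu.autocorr_eq _ 0]
  simpa only [sum_sum_lag_eq fun k : ℤ =>
    Complex.exp (-(Complex.I * ω * k)) • (autocorr γ u 0 k).map Complex.ofReal]
    using (hΦ ω).cesaro_smul

open scoped Matrix.Norms.L2Operator in
theorem IsPowerSpectrum.posSemidef (hu : IsStationary γ u) (hΦ : IsPowerSpectrum γ u Φ) (ω : ℝ) :
    (Φ ω).PosSemidef :=
  Matrix.nonneg_iff_posSemidef.1 <| ge_of_tendsto' (tendsto_periodogram hu hΦ ω) fun n =>
    (posSemidef_periodogram hu.memLp_two n ω).nonneg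

theorem trace_autocorr_zero (hu : ∀ k, MemLp (u k) 2 γ) (i : ℤ) :
    (autocorr γ u i 0).trace = ∫ z, ‖u i z‖ ^ 2 ∂γ := by
  simp only [Matrix.trace, Matrix.diag, autocorr, Matrix.of_apply, add_zero,
    EuclideanSpace.norm_sq_eq, Real.norm_eq_abs, sq_abs]
  rw [integral_finsetSum _ fun a _ => ((hu i).eval_piLp a).integrable_sq]
  simp only [sq]

theorem re_trace_periodogram (hu : ∀ k, MemLp (u k) 2 γ) (n : ℕ) (ω : ℝ) :
    (periodogram γ u n ω).trace.re =
      (n⁻¹ : ℝ) * ∑ i ∈ Finset.range n, ∑ j ∈ Finset.range n,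
        Real.cos ((j - i : ℤ) * ω) * (autocorr γ u i (j - i)).trace := by
  have htrace (A : Matrix (Fin m) (Fin m) ℝ) : (A.map Complex.ofReal).trace = (A.trace : ℂ) := by
    simp [Matrix.trace]
  simp only [periodogram_eq_sum hu, Matrix.trace_smul, Matrix.trace_sum, htrace, Complex.smul_re,
    Complex.re_sum, smul_eq_mul, Complex.re_mul_ofReal, re_exp_neg_I_mul]

theorem integral_re_trace_periodogram (hu : ∀ k, MemLp (u k) 2 γ) (n : ℕ) :
    ∫ ω in (0 : ℝ)..(2 * Real.pi), (periodogram γ u n ω).trace.re =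
      2 * Real.pi * ((n⁻¹ : ℝ) * ∑ k ∈ Finset.range n, ∫ z, ‖u k z‖ ^ 2 ∂γ) := by
  have hterm (i j : ℕ) : IntervalIntegrable
      (fun ω => Real.cos ((j - i : ℤ) * ω) * (autocorr γ u i (j - i)).trace)
      volume 0 (2 * Real.pi) :=
    Continuous.intervalIntegrable (by fun_prop) _ _
  have hrow (i : ℕ) : IntervalIntegrable
      (fun ω => ∑ j ∈ Finset.range n,
        Real.cos ((j - i : ℤ) * ω) * (autocorr γ u i (j - i)).trace)
      volume 0 (2 * Real.pi) :=
    Continuous.intervalIntegrable (by fun_prop) _ _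
  simp only [re_trace_periodogram hu, intervalIntegral.integral_const_mul]
  rw [intervalIntegral.integral_finsetSum fun i _ => hrow i, mul_left_comm,
    Finset.mul_sum _ _ (2 * Real.pi)]
  congr 1
  refine Finset.sum_congr rfl fun i hi => ?_
  rw [intervalIntegral.integral_finsetSum fun j _ => hterm i j]
  simp only [intervalIntegral.integral_mul_const, integral_cos_int_mul, sub_eq_zero, Nat.cast_inj,
    ite_mul, zero_mul, Finset.sum_ite_eq', hi, if_true, sub_self, trace_autocorr_zero hu]

end Periodogram

section Fatou

variable {α : Type*} [MeasurableSpace α] {μ : Measure α} {f : ℕ → α → ℝ} {F : α → ℝ}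

theorem lintegral_ofReal_le_liminf_ofReal_integral (hf : ∀ n, Integrable (f n) μ)
    (hpos : ∀ n x, 0 ≤ f n x) (hlim : ∀ x, Tendsto (fun n => f n x) atTop (𝓝 (F x))) :
    ∫⁻ x, ENNReal.ofReal (F x) ∂μ ≤ liminf (fun n => ENNReal.ofReal (∫ x, f n x ∂μ)) atTop :=
  calc ∫⁻ x, ENNReal.ofReal (F x) ∂μ
      = ∫⁻ x, liminf (fun n => ENNReal.ofReal (f n x)) atTop ∂μ :=
        lintegral_congr fun x => (ENNReal.tendsto_ofReal (hlim x)).liminf_eq.symm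
    _ ≤ liminf (fun n => ∫⁻ x, ENNReal.ofReal (f n x) ∂μ) atTop :=
        lintegral_liminf_le' fun n => (hf n).aemeasurable.ennreal_ofReal
    _ = liminf (fun n => ENNReal.ofReal (∫ x, f n x ∂μ)) atTop := by
        simp only [ofReal_integral_eq_lintegral_ofReal (hf _) (ae_of_all _ (hpos _))]

theorem integrable_of_tendsto_of_integral_le (hf : ∀ n, Integrable (f n) μ)
    (hpos : ∀ n x, 0 ≤ f n x) (hlim : ∀ x, Tendsto (fun n => f n x) atTop (𝓝 (F x))) {C : ℝ}
    (hC : ∀ n, ∫ x, f n x ∂μ ≤ C) : Integrable F μ := by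
  have hF : 0 ≤ F := fun x => ge_of_tendsto' (hlim x) fun n => hpos n x
  refine ⟨aestronglyMeasurable_of_tendsto_ae atTop (fun n => (hf n).aestronglyMeasurable)
    (ae_of_all _ hlim), (hasFiniteIntegral_iff_ofReal (ae_of_all _ hF)).2 ?_⟩
  calc ∫⁻ x, ENNReal.ofReal (F x) ∂μ
      ≤ liminf (fun n => ENNReal.ofReal (∫ x, f n x ∂μ)) atTop :=
        lintegral_ofReal_le_liminf_ofReal_integral hf hpos hlim
    _ ≤ ENNReal.ofReal C :=
        liminf_le_of_le (by isBoundedDefault) fun b hb =>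
          let ⟨n, hn⟩ := hb.exists
          hn.trans (ENNReal.ofReal_le_ofReal (hC n))
    _ < ⊤ := ENNReal.ofReal_lt_top

theorem ofReal_integral_le_liminf_ofReal_integral (hf : ∀ n, Integrable (f n) μ)
    (hpos : ∀ n x, 0 ≤ f n x) (hlim : ∀ x, Tendsto (fun n => f n x) atTop (𝓝 (F x))) :
    ENNReal.ofReal (∫ x, F x ∂μ) ≤ liminf (fun n => ENNReal.ofReal (∫ x, f n x ∂μ)) atTop := by
  refine le_trans ?_ (lintegral_ofReal_le_liminf_ofReal_integral hf hpos hlim)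
  have hF : 0 ≤ F := fun x => ge_of_tendsto' (hlim x) fun n => hpos n x
  rw [integral_eq_lintegral_of_nonneg_ae (ae_of_all _ hF)
    (aestronglyMeasurable_of_tendsto_ae atTop (fun n => (hf n).aestronglyMeasurable)
      (ae_of_all _ hlim))]
  exact ENNReal.ofReal_toReal_le

end Fatou

section Transfer

variable {m : ℕ} {Ω Z : Type*} [MeasurableSpace Ω] [MeasurableSpace Z] {P : Measure Ω}
  {γ : Measure Z} {x : ℤ → Ω → E m} {u : ℤ → Z → E m}

theorem identDistrib_of_map_eq_law (hx : ∀ k, AEMeasurable (x k) P) {f : Z → ℤ → E m}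
    (hf : AEMeasurable f γ) (hlaw : γ.map f = law P x) :
    IdentDistrib f (fun s k => x k s) γ P :=
  ⟨hf, aemeasurable_pi_iff.2 hx, hlaw⟩

theorem memLp_of_identDistrib
    (h : IdentDistrib (fun z k => u k z) (fun s k => x k s) γ P) {p : ℝ≥0∞} (k : ℤ)
    (hx : MemLp (x k) p P) : MemLp (u k) p γ :=
  (h.comp (measurable_pi_apply k)).memLp_iff.2 hx

theorem autocorr_eq_of_identDistrib
    (h : IdentDistrib (fun z k => u k z) (fun s k => x k s) γ P) (i k : ℤ) :
    autocorr γ u i k = autocorr P x i k := by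
  ext a b
  exact (h.comp (u := fun w => w i a * w (i + k) b) (by fun_prop)).integral_eq

theorem periodogram_eq_of_identDistrib (hx : ∀ k, MemLp (x k) 2 P)
    (h : IdentDistrib (fun z k => u k z) (fun s k => x k s) γ P) (n : ℕ) (ω : ℝ) :
    periodogram γ u n ω = periodogram P x n ω := by
  simp only [periodogram_eq_sum hx, periodogram_eq_sum fun k => memLp_of_identDistrib h k (hx k),
    autocorr_eq_of_identDistrib h]

end Transfer

section Spectral

variable {m : ℕ} {Z Z' : Type*} [MeasurableSpace Z] [MeasurableSpace Z'] {γ : Measure Z}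
  {γ' : Measure Z'} {u : ℤ → Z → E m} {v : ℤ → Z' → E m} {Φ Ψ : ℝ → Matrix (Fin m) (Fin m) ℂ}

theorem integral_re_trace_periodogram_le (hu : IsStationary γ u) (n : ℕ) :
    ∫ ω in (0 : ℝ)..(2 * Real.pi), (periodogram γ u n ω).trace.re ≤
      2 * Real.pi * ∫ z, ‖u 0 z‖ ^ 2 ∂γ := by
  have hpower (k : ℕ) : ∫ z, ‖u k z‖ ^ 2 ∂γ = ∫ z, ‖u 0 z‖ ^ 2 ∂γ := by
    rw [← trace_autocorr_zero hu.memLp_two, ← trace_autocorr_zero hu.memLp_two,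
      hu.autocorr_eq k 0]
  simp only [integral_re_trace_periodogram hu.memLp_two, hpower, Finset.sum_const,
    Finset.card_range, nsmul_eq_mul]
  refine mul_le_mul_of_nonneg_left ?_ Real.two_pi_pos.le
  rw [← mul_assoc]
  exact mul_le_of_le_one_left (integral_nonneg fun z => sq_nonneg _) inv_mul_le_one

theorem continuous_re_trace_gelbrich_periodogram (hu : ∀ k, MemLp (u k) 2 γ)
    (hv : ∀ k, MemLp (v k) 2 γ') (n : ℕ) :
    Continuous fun ω => (gelbrich (periodogram γ u n ω) (periodogram γ' v n ω)).trace.re :=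
  continuous_iff_continuousAt.2 fun ω => tendsto_re_trace_gelbrich
    (.of_forall (posSemidef_periodogram hu n)) (.of_forall (posSemidef_periodogram hv n))
    (posSemidef_periodogram hu n ω) (posSemidef_periodogram hv n ω)
    (continuous_periodogram hu n).continuousAt (continuous_periodogram hv n).continuousAt

theorem tendsto_re_trace_gelbrich_periodogram (hu : IsStationary γ u) (hv : IsStationary γ' v)
    (hΦ : IsPowerSpectrum γ u Φ) (hΨ : IsPowerSpectrum γ' v Ψ) (ω : ℝ) :
    Tendsto (fun n => (gelbrich (periodogram γ u n ω) (periodogram γ' v n ω)).trace.re) atTop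
      (𝓝 (gelbrich (Φ ω) (Ψ ω)).trace.re) :=
  tendsto_re_trace_gelbrich (.of_forall fun n => posSemidef_periodogram hu.memLp_two n ω)
    (.of_forall fun n => posSemidef_periodogram hv.memLp_two n ω) (hΦ.posSemidef hu ω)
    (hΨ.posSemidef hv ω) (tendsto_periodogram hu hΦ ω) (tendsto_periodogram hv hΨ ω)

theorem intervalIntegrable_re_trace_gelbrich (hu : IsStationary γ u) (hv : IsStationary γ' v)
    (hΦ : IsPowerSpectrum γ u Φ) (hΨ : IsPowerSpectrum γ' v Ψ) :
    IntervalIntegrable (fun ω => (gelbrich (Φ ω) (Ψ ω)).trace.re) volume 0 (2 * Real.pi) := by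
  have hpi : (0 : ℝ) ≤ 2 * Real.pi := Real.two_pi_pos.le
  have hcont := continuous_re_trace_gelbrich_periodogram hu.memLp_two hv.memLp_two
  have hcont_u (n : ℕ) : Continuous fun ω => (periodogram γ u n ω).trace.re :=
    continuous_re_trace.comp (continuous_periodogram hu.memLp_two n)
  have hcont_v (n : ℕ) : Continuous fun ω => (periodogram γ' v n ω).trace.re :=
    continuous_re_trace.comp (continuous_periodogram hv.memLp_two n)
  rw [intervalIntegrable_iff_integrableOn_Ioc_of_le hpi]
  refine integrable_of_tendsto_of_integral_le (fun n => (hcont n).integrableOn_Ioc)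
    (fun n ω => re_trace_gelbrich_nonneg (posSemidef_periodogram hu.memLp_two n ω)
      (posSemidef_periodogram hv.memLp_two n ω))
    (tendsto_re_trace_gelbrich_periodogram hu hv hΦ hΨ) (fun n => ?_)
    (C := 2 * Real.pi * ∫ z, ‖u 0 z‖ ^ 2 ∂γ + 2 * Real.pi * ∫ z, ‖v 0 z‖ ^ 2 ∂γ')
  rw [← intervalIntegral.integral_of_le hpi]
  calc ∫ ω in (0 : ℝ)..(2 * Real.pi),
        (gelbrich (periodogram γ u n ω) (periodogram γ' v n ω)).trace.re
      ≤ ∫ ω in (0 : ℝ)..(2 * Real.pi),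
          ((periodogram γ u n ω).trace.re + (periodogram γ' v n ω).trace.re) :=
        intervalIntegral.integral_mono_on hpi ((hcont n).intervalIntegrable _ _)
          (((hcont_u n).add (hcont_v n)).intervalIntegrable _ _)
          fun ω _ => re_trace_gelbrich_le _ _
    _ ≤ _ := by
        rw [intervalIntegral.integral_add ((hcont_u n).intervalIntegrable _ _)
          ((hcont_v n).intervalIntegrable _ _)]
        exact add_le_add (integral_re_trace_periodogram_le hu n)
          (integral_re_trace_periodogram_le hv n)

theorem ofReal_integral_re_trace_gelbrich_le_liminf (hu : IsStationary γ u)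
    (hv : IsStationary γ' v) (hΦ : IsPowerSpectrum γ u Φ) (hΨ : IsPowerSpectrum γ' v Ψ) :
    ENNReal.ofReal (1 / (2 * Real.pi) *
        ∫ ω in (0 : ℝ)..(2 * Real.pi), (gelbrich (Φ ω) (Ψ ω)).trace.re) ≤
      liminf (fun n : ℕ => ENNReal.ofReal (1 / (2 * Real.pi) *
        ∫ ω in (0 : ℝ)..(2 * Real.pi),
          (gelbrich (periodogram γ u (n + 1) ω) (periodogram γ' v (n + 1) ω)).trace.re)) atTop := by
  have hcont := continuous_re_trace_gelbrich_periodogram hu.memLp_two hv.memLp_two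
  simp only [intervalIntegral.integral_of_le Real.two_pi_pos.le, ← integral_const_mul]
  refine ofReal_integral_le_liminf_ofReal_integral
    (fun n => ((hcont (n + 1)).integrableOn_Ioc).const_mul _)
    (fun n ω => mul_nonneg (by positivity) (re_trace_gelbrich_nonneg
      (posSemidef_periodogram hu.memLp_two _ ω) (posSemidef_periodogram hv.memLp_two _ ω)))
    fun ω => ?_
  exact ((tendsto_re_trace_gelbrich_periodogram hu hv hΦ hΨ ω).comp
    (tendsto_add_atTop_nat 1)).const_mul _

end Spectral

section Cost

variable {m : ℕ} {Z : Type*} [MeasurableSpace Z] {γ : Measure Z} {u v : ℤ → Z → E m}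

theorem integral_re_trace_gelbrich_periodogram_le (hu : ∀ k, MemLp (u k) 2 γ)
    (hv : ∀ k, MemLp (v k) 2 γ) (n : ℕ) :
    ∫ ω in (0 : ℝ)..(2 * Real.pi),
        (gelbrich (periodogram γ u n ω) (periodogram γ v n ω)).trace.re ≤
      2 * Real.pi * ((n⁻¹ : ℝ) * ∑ k ∈ Finset.range n, ∫ z, ‖u k z - v k z‖ ^ 2 ∂γ) := by
  have hsub (k : ℤ) : MemLp ((u - v) k) 2 γ := (hu k).sub (hv k)
  have hle (ω : ℝ) : (gelbrich (periodogram γ u n ω) (periodogram γ v n ω)).trace.re ≤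
      (periodogram γ (u - v) n ω).trace.re := by
    rw [periodogram.eq_def γ (u - v), fourierSum_sub]
    exact re_trace_gelbrich_crossMoment_le (memLp_fourierSum hu n ω) (memLp_fourierSum hv n ω)
  refine (intervalIntegral.integral_mono_on Real.two_pi_pos.le
    ((continuous_re_trace_gelbrich_periodogram hu hv n).intervalIntegrable _ _)
    ((continuous_re_trace.comp (continuous_periodogram hsub n)).intervalIntegrable _ _)
    fun ω _ => hle ω).trans_eq ?_
  exact integral_re_trace_periodogram hsub n

theorem lintegral_enorm_stack_sub (hu : ∀ k, MemLp (u k) 2 γ) (hv : ∀ k, MemLp (v k) 2 γ)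
    (i : ℕ) :
    ∫⁻ z, ‖stack (fun k => u k z) i - stack (fun k => v k z) i‖ₑ ^ (2 : ℝ) ∂γ =
      ENNReal.ofReal (∑ k ∈ Finset.range (i + 1), ∫ z, ‖u k z - v k z‖ ^ 2 ∂γ) := by
  have hint (k : ℕ) : Integrable (fun z => ‖u k z - v k z‖ ^ 2) γ :=
    ((hu k).sub (hv k)).norm.integrable_sq
  rw [← integral_finsetSum _ fun k _ => hint k, ofReal_integral_eq_lintegral_ofReal
    (integrable_finsetSum _ fun k _ => hint k)
    (ae_of_all _ fun z => Finset.sum_nonneg fun k _ => sq_nonneg _)]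
  refine lintegral_congr fun z => ?_
  rw [← ofReal_norm, ENNReal.ofReal_rpow_of_nonneg (norm_nonneg _) zero_le_two,
    Real.rpow_two, PiLp.norm_sq_eq_of_L2, Finset.sum_range]
  rfl

theorem ofReal_integral_re_trace_gelbrich_periodogram_le (hu : ∀ k, MemLp (u k) 2 γ)
    (hv : ∀ k, MemLp (v k) 2 γ) (i : ℕ) :
    ENNReal.ofReal (1 / (2 * Real.pi) * ∫ ω in (0 : ℝ)..(2 * Real.pi),
        (gelbrich (periodogram γ u (i + 1) ω) (periodogram γ v (i + 1) ω)).trace.re) ≤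
      (∫⁻ z, ‖stack (fun k => u k z) i - stack (fun k => v k z) i‖ₑ ^ (2 : ℝ) ∂γ) /
        ((i : ℝ≥0∞) + 1) := by
  have hcast : (i : ℝ≥0∞) + 1 = ENNReal.ofReal (i + 1 : ℕ) := by
    rw [ENNReal.ofReal_natCast, Nat.cast_succ]
  rw [lintegral_enorm_stack_sub hu hv, hcast, ← ENNReal.ofReal_div_of_pos (by positivity)]
  refine ENNReal.ofReal_le_ofReal ?_
  rw [one_div, inv_mul_le_iff₀ Real.two_pi_pos, div_eq_inv_mul]
  exact integral_re_trace_gelbrich_periodogram_le hu hv (i + 1)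

end Cost

section Coupling

variable {m : ℕ} {Ω Ω' : Type*} [MeasurableSpace Ω] [MeasurableSpace Ω'] {P : Measure Ω}
  {P' : Measure Ω'} {x : ℤ → Ω → E m} {y : ℤ → Ω' → E m}

theorem ofReal_integral_re_trace_gelbrich_periodogram_le_of_mem_couplings
    (hx : ∀ k, MemLp (x k) 2 P) (hy : ∀ k, MemLp (y k) 2 P')
    {γ : Measure ((ℤ → E m) × (ℤ → E m))} (hγ : γ ∈ couplings (law P x) (law P' y)) (i : ℕ) :
    ENNReal.ofReal (1 / (2 * Real.pi) * ∫ ω in (0 : ℝ)..(2 * Real.pi),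
        (gelbrich (periodogram P x (i + 1) ω) (periodogram P' y (i + 1) ω)).trace.re) ≤
      (∫⁻ z, ‖stack z.1 i - stack z.2 i‖ₑ ^ (2 : ℝ) ∂γ) / ((i : ℝ≥0∞) + 1) := by
  have hfst : IdentDistrib (fun z : (ℤ → E m) × (ℤ → E m) => fun k => z.1 k) _ γ P :=
    identDistrib_of_map_eq_law (fun k => (hx k).aemeasurable) measurable_fst.aemeasurable hγ.1
  have hsnd : IdentDistrib (fun z : (ℤ → E m) × (ℤ → E m) => fun k => z.2 k) _ γ P' :=
    identDistrib_of_map_eq_law (fun k => (hy k).aemeasurable) measurable_snd.aemeasurable hγ.2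
  have hper_x (n : ℕ) (ω : ℝ) : periodogram P x n ω = periodogram γ (fun k z => z.1 k) n ω :=
    (periodogram_eq_of_identDistrib hx hfst n ω).symm
  have hper_y (n : ℕ) (ω : ℝ) : periodogram P' y n ω = periodogram γ (fun k z => z.2 k) n ω :=
    (periodogram_eq_of_identDistrib hy hsnd n ω).symm
  simp only [hper_x, hper_y]
  exact ofReal_integral_re_trace_gelbrich_periodogram_le
    (fun k => memLp_of_identDistrib hfst k (hx k)) (fun k => memLp_of_identDistrib hsnd k (hy k)) i

end Coupling

end SpectralW2

theorem corollary1_general {m : ℕ} {Ω Ω' : Type*} [MeasurableSpace Ω] [MeasurableSpace Ω']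
    (P : Measure Ω) (P' : Measure Ω') (x : ℤ → Ω → SpectralW2.E m) (y : ℤ → Ω' → SpectralW2.E m)
    (hx : SpectralW2.IsStationary P x) (hy : SpectralW2.IsStationary P' y)
    (Φx Φy : ℝ → Matrix (Fin m) (Fin m) ℂ)
    (hΦx : SpectralW2.IsPowerSpectrum P x Φx) (hΦy : SpectralW2.IsPowerSpectrum P' y Φy) :
    IntervalIntegrable (fun ω => (SpectralW2.gelbrich (Φx ω) (Φy ω)).trace.re)
        volume 0 (2 * Real.pi) ∧
      ENNReal.ofReal (Real.sqrt ((1 / (2 * Real.pi)) *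
          ∫ ω in (0 : ℝ)..(2 * Real.pi), (SpectralW2.gelbrich (Φx ω) (Φy ω)).trace.re)) ≤
        SpectralW2.avgWasserstein 2 (SpectralW2.law P x) (SpectralW2.law P' y) := by
  refine ⟨SpectralW2.intervalIntegrable_re_trace_gelbrich hx hy hΦx hΦy, ?_⟩
  have hnonneg : 0 ≤ 1 / (2 * Real.pi) *
      ∫ ω in (0 : ℝ)..(2 * Real.pi), (SpectralW2.gelbrich (Φx ω) (Φy ω)).trace.re :=
    mul_nonneg (by positivity) <| intervalIntegral.integral_nonneg Real.two_pi_pos.le fun ω _ =>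
      SpectralW2.re_trace_gelbrich_nonneg (hΦx.posSemidef hx ω) (hΦy.posSemidef hy ω)
  rw [SpectralW2.avgWasserstein, Real.sqrt_eq_rpow,
    ← ENNReal.ofReal_rpow_of_nonneg hnonneg one_half_pos.le]
  refine ENNReal.rpow_le_rpow (le_iInf₂ fun γ hγ => ?_) one_half_pos.le
  refine (SpectralW2.ofReal_integral_re_trace_gelbrich_le_liminf hx hy hΦx hΦy).trans ?_
  exact (liminf_le_liminf <| .of_forall <|
    SpectralW2.ofReal_integral_re_trace_gelbrich_periodogram_le_of_mem_couplings hx.memLp_two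
      hy.memLp_two hγ).trans liminf_le_limsup

theorem corollary1 {m : ℕ} {Ω Ω' : Type*} [MeasurableSpace Ω] [MeasurableSpace Ω']
    (P : Measure Ω) [IsProbabilityMeasure P] (P' : Measure Ω') [IsProbabilityMeasure P']
    (x : ℤ → Ω → SpectralW2.E m) (y : ℤ → Ω' → SpectralW2.E m)
    (hx_meas : ∀ k, Measurable (x k)) (hy_meas : ∀ k, Measurable (y k))
    (hx : SpectralW2.IsStationary P x) (hy : SpectralW2.IsStationary P' y)
    (Φx Φy : ℝ → Matrix (Fin m) (Fin m) ℂ)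
    (hΦx : SpectralW2.IsPowerSpectrum P x Φx) (hΦy : SpectralW2.IsPowerSpectrum P' y Φy) :
    IntervalIntegrable (fun ω => (SpectralW2.gelbrich (Φx ω) (Φy ω)).trace.re)
        volume 0 (2 * Real.pi) ∧
      ENNReal.ofReal (Real.sqrt ((1 / (2 * Real.pi)) *
          ∫ ω in (0 : ℝ)..(2 * Real.pi), (SpectralW2.gelbrich (Φx ω) (Φy ω)).trace.re)) ≤
        SpectralW2.avgWasserstein 2 (SpectralW2.law P x) (SpectralW2.law P' y) :=
  corollary1_general P P' x y hx hy Φx Φy hΦx hΦy
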